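/- **Setting.** Let $X\in\mathbb R^{n\times p}$ be a fixed design matrix with invertible Gram matrix $\Sigma=X^\top X$, let $\beta\in\mathbb R^p$, and let $Y=X\beta+\varepsilon$ with $\varepsilon\sim\mathcal N(0,I_n)$. Put $\mathcal H_0=\{j\in[p]:\beta_j=0\}$. Let $s\in\mathbb R^p$ be nonnegative with $C:=2\,\mathrm{diag}\{s\}-\mathrm{diag}\{s\}\Sigma^{-1}\mathrm{diag}\{s\}\succeq 0$. Let $U^{(1)},\dots,U^{(M)}$ be random $n\times p$ matrices, each uniformly distributed on the set of matrices $U$ with $U^\top U=I_p$ and $U^\top X=0$ (assumed nonempty), such that $(U^{(1)},\dots,U^{(M)})$ is independent of $\varepsilon$; they may for instance be i.i.d., but nothing is assumed about their joint distribution. For each $m\in[M]$ let $\mathcal W^{(m)}$ be a measurable map sending $(G,y)\in\mathbb R^{n\times 2p}\times\mathbb R^n$ to $\mathbb R^p$ such that - (sufficiency) $\mathcal W^{(m)}(G,y)$ depends on $(G,y)$ only through $(G^\top G,\,G^\top y)$; - (antisymmetry) exchanging columns $j$ and $p+j$ of $G$ changes the sign of the $j$-th coordinate of $\mathcal W^{(m)}(G,y)$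 and leaves the other coordinates unchanged, for every $j\in[p]$. **Derandomized fixed-X knockoffs.** Given $\alpha_{\mathrm{kn}},\alpha_{\mathrm{ebh}}\in(0,1)$, for each $m=1,\dots,M$ compute $$\tilde X^{(m)}=X\bigl(I_p-\Sigma^{-1}\mathrm{diag}\{s\}\bigr)-U^{(m)}C^{1/2},\qquad W^{(m)}=\mathcal W^{(m)}\bigl([X,\tilde X^{(m)}],Y\bigr),$$ the threshold $T^{(m)}$, defined as the smallest $t\in\{|W^{(m)}_j|:j\in[p]\}\setminus\{0\}$ such that $$\frac{1+\#\{j:W^{(m)}_j\le -t\}}{\#\{j:W^{(m)}_j\ge t\}}\le\alpha_{\mathrm{kn}}\quad\text{or}\quad \#\{j:W^{(m)}_j\ge t\}<\frac1{\alpha_{\mathrm{kn}}}$$ (with $T^{(m)}=+\infty$ if there is none, and with the fraction read as $+\infty$ when its denominator is $0$), and the values $$e^{(m)}_j=p\cdot\frac{\mathbf 1\{W^{(m)}_j\ge T^{(m)}\}}{1+\#\{k:W^{(m)}_k\le -T^{(m)}\}},\qquad j\in[p].$$ Let $e^{\mathrm{avg}}_j=\frac1M\sum_{m=1}^M e^{(m)}_j$,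 with decreasing order statistics $e^{\mathrm{avg}}_{(1)}\ge\dots\ge e^{\mathrm{avg}}_{(p)}$; let $\hat k=\max\{k\in[p]:e^{\mathrm{avg}}_{(k)}\ge p/(\alpha_{\mathrm{ebh}}k)\}$, with $\hat k=0$ if this set is empty. The selected set is $\mathcal S=\{j\in[p]:e^{\mathrm{avg}}_j\ge p/(\alpha_{\mathrm{ebh}}\hat k)\}$, and $\mathcal S=\emptyset$ if $\hat k=0$. **Theorem.** For all $\alpha_{\mathrm{kn}},\alpha_{\mathrm{ebh}}\in(0,1)$ and every $M\ge1$, $$\mathrm{FDR}=\mathbb E\left[\frac{|\mathcal S\cap\mathcal H_0|}{|\mathcal S|\vee1}\right]\le\alpha_{\mathrm{ebh}}.$$ -/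

import Mathlib

open MeasureTheory ProbabilityTheory
open scoped MatrixOrder

namespace FixedXKnockoffs

noncomputable section

/-- The product σ-algebra on matrices. -/
instance instMeasurableSpaceMatrix {n p : Type*} :
    MeasurableSpace (Matrix n p ℝ) :=
  inferInstanceAs (MeasurableSpace (n → p → ℝ))

/-! ### Fixed-X knockoff matrices -/

/-- The matrix `2 diag(s) - diag(s) Σ⁻¹ diag(s)`, where `Σ = Xᵀ X`. -/
def knockoffCov {n p : ℕ} (X : Matrix (Fin n) (Fin p) ℝ) (s : Fin p → ℝ) :
    Matrix (Fin p) (Fin p) ℝ :=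
  (2 : ℝ) • Matrix.diagonal s - Matrix.diagonal s * (X.transpose * X)⁻¹ * Matrix.diagonal s

/-- The knockoff matrix
`X (I - Σ⁻¹ diag(s)) - U (2 diag(s) - diag(s) Σ⁻¹ diag(s))^{1/2}`, with `Σ = Xᵀ X`; the square
root is the positive semidefinite one. -/
def knockoffMatrix {n p : ℕ} (X : Matrix (Fin n) (Fin p) ℝ) (s : Fin p → ℝ)
    (U : Matrix (Fin n) (Fin p) ℝ) : Matrix (Fin n) (Fin p) ℝ :=
  X * (1 - (X.transpose * X)⁻¹ * Matrix.diagonal s) - U * CFC.sqrt (knockoffCov X s)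

/-- The `n × p` matrices with orthonormal columns, all orthogonal to the columns of `X`. -/
def orthonormalTo {n p : ℕ} (X : Matrix (Fin n) (Fin p) ℝ) : Set (Matrix (Fin n) (Fin p) ℝ) :=
  {U | U.transpose * U = 1 ∧ U.transpose * X = 0}

/-- `ν` is the uniform distribution on `orthonormalTo X`: the probability measure carried by this
set that is invariant under the orthogonal transformations of `ℝⁿ` fixing the columns of `X`.
(These form a compact group that acts transitively on the set, so there is exactly one such
measure as soon as the set is nonempty.) -/
structure IsUniformOrthonormalTo {n p : ℕ} (X : Matrix (Fin n) (Fin p) ℝ)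
    (ν : Measure (Matrix (Fin n) (Fin p) ℝ)) : Prop where
  isProbabilityMeasure : IsProbabilityMeasure ν
  ae_mem : ∀ᵐ U ∂ν, U ∈ orthonormalTo X
  map_mul_left : ∀ Q ∈ Matrix.orthogonalGroup (Fin n) ℝ, Q * X = X →
    ν.map (fun U => Q * U) = ν

/-! ### Feature importance statistics -/

/-- Exchange the `j`-th column of the first block with the `j`-th column of the second block. -/
def swapCols {n p : ℕ} (j : Fin p) (G : Matrix (Fin n) (Fin p ⊕ Fin p) ℝ) :
    Matrix (Fin n) (Fin p ⊕ Fin p) ℝ :=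
  G.submatrix id (Equiv.swap (Sum.inl j) (Sum.inr j))

/-- A feature importance statistic for fixed-X knockoffs, as a function of the augmented design
`G = [X, X̃]` and of the response `y`. -/
structure IsFeatureStatistic {n p : ℕ}
    (W : Matrix (Fin n) (Fin p ⊕ Fin p) ℝ → (Fin n → ℝ) → (Fin p → ℝ)) : Prop where
  measurable : Measurable fun q : Matrix (Fin n) (Fin p ⊕ Fin p) ℝ × (Fin n → ℝ) => W q.1 q.2
  /-- Sufficiency: `W` depends on the data only through `Gᵀ G` and `Gᵀ y`. -/
  sufficiency : ∃ f : Matrix (Fin p ⊕ Fin p) (Fin p ⊕ Fin p) ℝ → (Fin p ⊕ Fin p → ℝ) →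
      (Fin p → ℝ),
    ∀ G y, W G y = f (G.transpose * G) (G.transpose.mulVec y)
  /-- Antisymmetry: swapping the `j`-th feature with its knockoff flips the sign of `W_j` and
  leaves the other coordinates unchanged. -/
  antisymmetry : ∀ G y j, W (swapCols j G) y = Function.update (W G y) j (-(W G y j))

/-! ### Knockoff e-values -/

/-- The condition defining the threshold:
`(1 + #{j : W_j ≤ -t}) / #{j : W_j ≥ t} ≤ α` (false when the denominator is `0`), or
`#{j : W_j ≥ t} < 1 / α`. -/
def StopCondition {p : ℕ} (α : ℝ) (W : Fin p → ℝ) (t : ℝ) : Prop :=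
  (1 + (Finset.univ.filter fun j => W j ≤ -t).card : ℝ)
      ≤ α * (Finset.univ.filter fun j => t ≤ W j).card ∨
    ((Finset.univ.filter fun j => t ≤ W j).card : ℝ) < 1 / α

/-- The knockoff threshold `T`: the smallest `t` among the nonzero magnitudes `|W_j|` that satisfies
the stopping condition, and `+∞` if there is none. -/
def threshold {p : ℕ} (α : ℝ) (W : Fin p → ℝ) : EReal :=
  sInf {x : EReal | ∃ t : ℝ, x = (t : EReal) ∧ 0 < t ∧ (∃ j, |W j| = t) ∧ StopCondition α W t}

open Classical in
/-- The e-values `e_j = p * 1{W_j ≥ T} / (1 + #{k : W_k ≤ -T})`. -/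
def eValue {p : ℕ} (α : ℝ) (W : Fin p → ℝ) (j : Fin p) : ℝ :=
  p * ((if threshold α W ≤ (W j : EReal) then 1 else 0) /
    (1 + (Finset.univ.filter fun k => (W k : EReal) ≤ -threshold α W).card))

/-! ### The e-BH procedure -/

/-- The values of `e` in decreasing order: `orderStat e i` is the `(i+1)`-st largest. -/
def orderStat {p : ℕ} (e : Fin p → ℝ) : Fin p → ℝ :=
  e ∘ Tuple.sort fun j => -e j

/-- `k̂ = max {k ∈ {1, …, p} : e_(k) ≥ p / (α k)}`, and `0` if this set is empty. -/
def kHat {p : ℕ} (α : ℝ) (e : Fin p → ℝ) : ℕ :=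
  (Finset.univ.filter fun i : Fin p => (p : ℝ) / (α * ((i : ℕ) + 1 : ℕ)) ≤ orderStat e i).sup
    fun i => (i : ℕ) + 1

/-- The e-BH selected set `{j : e_j ≥ p / (α k̂)}`, empty when `k̂ = 0`. -/
def ebhSet {p : ℕ} (α : ℝ) (e : Fin p → ℝ) : Finset (Fin p) :=
  Finset.univ.filter fun j => 0 < kHat α e ∧ (p : ℝ) / (α * kHat α e) ≤ e j

/-! ### The derandomized procedure and its false discovery proportion -/

/-- The set selected by derandomized fixed-X knockoffs on the data `(X, y)`, for the draws
`U 1, …, U M` and the feature importance statistics `W 1, …, W M`. -/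
def derandomizedSelection {n p M : ℕ} (αkn αebh : ℝ) (X : Matrix (Fin n) (Fin p) ℝ)
    (s : Fin p → ℝ)
    (W : Fin M → Matrix (Fin n) (Fin p ⊕ Fin p) ℝ → (Fin n → ℝ) → (Fin p → ℝ))
    (U : Fin M → Matrix (Fin n) (Fin p) ℝ) (y : Fin n → ℝ) : Finset (Fin p) :=
  ebhSet αebh fun j =>
    (1 / (M : ℝ)) * ∑ m, eValue αkn (W m (Matrix.fromCols X (knockoffMatrix X s (U m))) y) j

/-- The nulls of the linear model with coefficient vector `β`. -/
def nulls {p : ℕ} (β : Fin p → ℝ) : Finset (Fin p) :=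
  Finset.univ.filter fun j => β j = 0

/-- The false discovery proportion `|S ∩ H₀| / (|S| ∨ 1)`. -/
def fdp {p : ℕ} (S H₀ : Finset (Fin p)) : ℝ :=
  ((S ∩ H₀).card : ℝ) / max (S.card : ℝ) 1

end

end FixedXKnockoffs

namespace FixedXKnockoffs

/-! The e-BH step needs no assumption on dependence: pointwise, the false discovery proportion is at
most `α / p` times the sum of the null e-values (`fdp_ebhSet_le`). By linearity the average over `m`
is harmless, and it suffices that for each single draw the null e-values have total expectation at
most `p`.

By independence, a draw `U` can be frozen. The reflection exchanging a null column with its knockoff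
fixes the mean `X β` and preserves the Gaussian noise. With sufficiency and antisymmetry, flipping
the sign of that one null statistic therefore preserves the law of the whole vector
(`integral_flipSign`). Hence `E e_j(w)` equals `E e_j(flipSign j w)` for each null `j`.

What remains is deterministic: `∑ j, e_j(flipSign j w) ≤ p` for every vector `w`
(`sum_eValue_flipSign_le`). All coordinates with a nonzero term share one threshold, and each of
them is counted in the denominators of the others. Only one-coordinate flips are needed, so this
replaces a martingale argument on the joint law of the null signs. -/

/-! ### Sign flips and the deterministic bound on e-values -/

/-- Change the sign of the `j`-th coordinate. -/
def flipSign {p : ℕ} (j : Fin p) (w : Fin p → ℝ) : Fin p → ℝ :=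
  Function.update w j (-(w j))

lemma abs_flipSign {p : ℕ} (j i : Fin p) (w : Fin p → ℝ) : |flipSign j w i| = |w i| := by
  by_cases h : i = j
  · subst h; simp [flipSign]
  · simp [flipSign, h]

lemma threshold_le {p : ℕ} {α : ℝ} {w : Fin p → ℝ} {t : ℝ} (ht : 0 < t) (hj : ∃ j, |w j| = t)
    (hs : StopCondition α w t) : threshold α w ≤ t :=
  sInf_le ⟨t, rfl, ht, hj, hs⟩

/-- The candidates lie among the finitely many `|w j|`, so an infimum over a nonempty set of them is
attained. -/
lemma exists_eq_threshold {p : ℕ} {α : ℝ} {w : Fin p → ℝ} (h : threshold α w ≠ ⊤) :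
    ∃ t : ℝ, threshold α w = t ∧ 0 < t ∧ (∃ j, |w j| = t) ∧ StopCondition α w t := by
  set A := {x : EReal | ∃ t : ℝ, x = (t : EReal) ∧ 0 < t ∧ (∃ j, |w j| = t) ∧
    StopCondition α w t} with hA
  have hfin : A.Finite := by
    refine (Set.finite_range fun j => ((|w j| : ℝ) : EReal)).subset ?_
    rintro x ⟨t, rfl, -, ⟨j, rfl⟩, -⟩
    exact ⟨j, rfl⟩
  have hne : A.Nonempty := by
    by_contra hne
    rw [Set.not_nonempty_iff_eq_empty] at hne
    exact h (by rw [threshold, ← hA, hne, sInf_empty])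
  obtain ⟨t, h1, h2⟩ := hne.csInf_mem hfin
  exact ⟨t, h1, h2⟩

lemma card_flipSign_le {p : ℕ} {w : Fin p → ℝ} {j : Fin p} {t : ℝ} (ht : 0 < t)
    (hj : t ≤ -w j) :
    (Finset.univ.filter fun i => flipSign j w i ≤ -t).card =
      (Finset.univ.filter fun i => w i ≤ -t).card - 1 := by
  rw [← Finset.card_erase_of_mem (a := j) (by rw [Finset.mem_filter]; simp; linarith)]
  congr 1
  ext i
  simp only [Finset.mem_filter, Finset.mem_univ, true_and, Finset.mem_erase]
  by_cases h : i = j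
  · subst h; simp [flipSign]; linarith
  · simp [flipSign, h]

lemma card_le_flipSign {p : ℕ} {w : Fin p → ℝ} {j : Fin p} {t : ℝ} (ht : 0 < t)
    (hj : t ≤ -w j) :
    (Finset.univ.filter fun i => t ≤ flipSign j w i).card =
      (Finset.univ.filter fun i => t ≤ w i).card + 1 := by
  rw [← Finset.card_insert_of_notMem (a := j) (by rw [Finset.mem_filter]; simp; linarith)]
  congr 1
  ext i
  simp only [Finset.mem_filter, Finset.mem_univ, true_and, Finset.mem_insert]
  by_cases h : i = j
  · subst h; simp [flipSign]; linarith
  · simp [flipSign, h]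

/-- If the threshold `t` for `k` were smaller, both `w j` and `w k` would be at most `-t`. Flipping
either one then moves exactly one coordinate from the negative count at `t` to the positive count,
so `t` would be admissible for `j` too. By symmetry the two thresholds are equal. -/
lemma threshold_flipSign_le {p : ℕ} {α : ℝ} {w : Fin p → ℝ} {j k : Fin p}
    (hj : threshold α (flipSign j w) ≤ ((-w j : ℝ) : EReal))
    (hk : threshold α (flipSign k w) ≤ ((-w k : ℝ) : EReal)) :
    threshold α (flipSign j w) ≤ threshold α (flipSign k w) := by
  by_contra! hlt
  obtain ⟨t, ht, hpos, ⟨i, hi⟩, hs⟩ := exists_eq_threshold (ne_top_of_lt hlt)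
  rw [ht] at hk hlt
  have hk' : t ≤ -w k := EReal.coe_le_coe_iff.1 hk
  have hj' : t ≤ -w j := EReal.coe_le_coe_iff.1 (hlt.le.trans hj)
  refine hlt.not_ge (threshold_le hpos ⟨i, ?_⟩ ?_)
  · rw [abs_flipSign] at hi ⊢; exact hi
  · unfold StopCondition at hs ⊢
    rw [card_flipSign_le hpos hk', card_le_flipSign hpos hk'] at hs
    rw [card_flipSign_le hpos hj', card_le_flipSign hpos hj']
    exact hs

/-- Only indices in `A` contribute. For `j ∈ A`, every other member of `A` lies below minus the
common threshold and is untouched by the flip at `j`, so the denominator is at least `1 + (|A| - 1)`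
and each term is at most `p / |A|`. -/
lemma sum_eValue_flipSign_le {p : ℕ} (α : ℝ) (w : Fin p → ℝ) :
    ∑ j, eValue α (flipSign j w) j ≤ p := by
  classical
  set A := Finset.univ.filter fun j => threshold α (flipSign j w) ≤ ((-w j : ℝ) : EReal) with hA
  have key : ∀ j, eValue α (flipSign j w) j ≤ p * (if j ∈ A then ((A.card : ℝ))⁻¹ else 0) := by
    intro j
    have hself : flipSign j w j = -w j := by simp [flipSign]
    unfold eValue
    rw [hself]
    refine mul_le_mul_of_nonneg_left ?_ (Nat.cast_nonneg _)
    by_cases hj : threshold α (flipSign j w) ≤ ((-w j : ℝ) : EReal)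
    · have hjA : j ∈ A := Finset.mem_filter.2 ⟨Finset.mem_univ j, hj⟩
      rw [if_pos hj, if_pos hjA, one_div]
      have hApos : (0 : ℝ) < A.card := by exact_mod_cast Finset.card_pos.2 ⟨j, hjA⟩
      refine inv_anti₀ hApos ?_
      have hsub : A.erase j ⊆ Finset.univ.filter fun k =>
          ((flipSign j w k : ℝ) : EReal) ≤ -threshold α (flipSign j w) := by
        intro k hk
        obtain ⟨hkj, hkA⟩ := Finset.mem_erase.1 hk
        have hk' : threshold α (flipSign k w) ≤ ((-w k : ℝ) : EReal) :=
          (Finset.mem_filter.1 hkA).2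
        have h1 := (threshold_flipSign_le hj hk').trans hk'
        have : flipSign j w k = w k := by simp [flipSign, hkj]
        simp only [Finset.mem_filter, Finset.mem_univ, true_and, this]
        rw [EReal.le_neg]
        simpa using h1
      have := Finset.card_le_card hsub
      rw [Finset.card_erase_of_mem hjA] at this
      have h2 : A.card ≤ 1 + (Finset.univ.filter fun k =>
          ((flipSign j w k : ℝ) : EReal) ≤ -threshold α (flipSign j w)).card := by omega
      exact_mod_cast h2
    · rw [if_neg hj, zero_div]
      split_ifs
      · positivity
      · exact le_rfl
  refine (Finset.sum_le_sum fun j _ => key j).trans ?_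
  rw [← Finset.mul_sum, Finset.sum_ite_mem, Finset.univ_inter, Finset.sum_const, nsmul_eq_mul]
  exact mul_le_of_le_one_right (Nat.cast_nonneg _) mul_inv_le_one

lemma eValue_nonneg {p : ℕ} (α : ℝ) (w : Fin p → ℝ) (j : Fin p) : 0 ≤ eValue α w j := by
  unfold eValue
  split_ifs <;> positivity

lemma eValue_le {p : ℕ} (α : ℝ) (w : Fin p → ℝ) (j : Fin p) : eValue α w j ≤ p := by
  unfold eValue
  refine mul_le_of_le_one_right (Nat.cast_nonneg _) (div_le_one_of_le₀ ?_ (by positivity))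
  split_ifs
  · exact le_add_of_nonneg_right (Nat.cast_nonneg _)
  · positivity

/-! ### The e-BH procedure -/

/-- Trades the sorting permutation for a count, which serves both the size of the selected set and
the measurability of `kHat`. -/
lemma le_orderStat_iff {p : ℕ} (e : Fin p → ℝ) (i : Fin p) (c : ℝ) :
    c ≤ orderStat e i ↔ (i : ℕ) < (Finset.univ.filter fun j => c ≤ e j).card := by
  have hanti : Antitone (orderStat e) := by
    intro a b hab
    have := Tuple.monotone_sort (fun j => -e j) hab
    simpa [orderStat] using this
  rw [← Tuple.lt_card_ge_iff_apply_ge_of_antitone hanti]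
  have : (Finset.univ.filter fun j => c ≤ orderStat e j).card =
      (Finset.univ.filter fun j => c ≤ e j).card :=
    Finset.card_equiv (Tuple.sort fun j => -e j) fun j => by
      rw [Finset.mem_filter, Finset.mem_filter]
      simp [orderStat]
  rw [this]

lemma kHat_le_card_ebhSet {p : ℕ} (α : ℝ) (e : Fin p → ℝ) :
    kHat α e ≤ (ebhSet α e).card := by
  rcases Nat.eq_zero_or_pos (kHat α e) with h0 | hpos
  · omega
  set B := Finset.univ.filter fun i : Fin p =>
    (p : ℝ) / (α * ((i : ℕ) + 1 : ℕ)) ≤ orderStat e i with hB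
  have hne : B.Nonempty := by
    by_contra hne
    rw [Finset.not_nonempty_iff_eq_empty] at hne
    rw [kHat, ← hB, hne] at hpos
    simp at hpos
  obtain ⟨i, hi, heq⟩ := Finset.exists_mem_eq_sup B hne fun i => (i : ℕ) + 1
  have hk : kHat α e = (i : ℕ) + 1 := heq
  -- The maximum is attained at `i`, with `k̂ = i + 1`, so the strict bound `i < card` is exactly
  -- `k̂ ≤ card`.
  have h1 := (le_orderStat_iff e i _).1 (Finset.mem_filter.1 hi).2
  rw [← hk] at h1
  have h2 : ebhSet α e = Finset.univ.filter fun j => (p : ℝ) / (α * kHat α e) ≤ e j := by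
    simp [ebhSet, hpos]
  rw [h2]
  omega

/-- Each selected `j` satisfies `1 ≤ α e_j k̂ / p`. Summing over the selected members of `H` and
dividing by `|S| ≥ k̂` cancels `k̂`. -/
lemma fdp_ebhSet_le {p : ℕ} {α : ℝ} (hα : 0 < α) {e : Fin p → ℝ} (he : ∀ j, 0 ≤ e j)
    (H : Finset (Fin p)) :
    fdp (ebhSet α e) H ≤ α / p * ∑ j ∈ H, e j := by
  have hcard := kHat_le_card_ebhSet α e
  have hR : 0 ≤ α / p * ∑ j ∈ H, e j :=
    mul_nonneg (by positivity) (Finset.sum_nonneg fun j _ => he j)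
  rcases Nat.eq_zero_or_pos (kHat α e) with h0 | hpos
  · have : ebhSet α e = ∅ := by simp [ebhSet, h0]
    simpa [fdp, this] using hR
  unfold fdp
  rw [div_le_iff₀ (by positivity)]
  have hk : (0 : ℝ) < kHat α e := by exact_mod_cast hpos
  have hkS : (kHat α e : ℝ) ≤ max ((ebhSet α e).card : ℝ) 1 :=
    le_max_of_le_left (by exact_mod_cast hcard)
  refine le_trans ?_ (mul_le_mul_of_nonneg_left hkS hR)
  have h1 : ((ebhSet α e ∩ H).card : ℝ) ≤ ∑ j ∈ ebhSet α e ∩ H, α / p * e j * kHat α e := by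
    rw [Finset.cast_card]
    refine Finset.sum_le_sum fun j hj => ?_
    have hj' := (Finset.mem_filter.1 (Finset.mem_inter.1 hj).1).2.2
    have hp : (0 : ℝ) < p := by exact_mod_cast j.pos
    rw [div_le_iff₀ (by positivity)] at hj'
    rw [div_mul_eq_mul_div, div_mul_eq_mul_div, le_div_iff₀ hp]
    linarith
  refine h1.trans ?_
  rw [mul_assoc, Finset.sum_mul, Finset.mul_sum]
  refine (Finset.sum_le_sum_of_subset_of_nonneg Finset.inter_subset_right fun j _ _ => ?_).trans
    (Finset.sum_le_sum fun j _ => (mul_assoc _ _ _).le)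
  have := he j
  positivity

lemma fdp_nonneg {p : ℕ} (S H : Finset (Fin p)) : 0 ≤ fdp S H := by
  unfold fdp; positivity

lemma fdp_le_one {p : ℕ} (S H : Finset (Fin p)) : fdp S H ≤ 1 := by
  unfold fdp
  refine div_le_one_of_le₀ (le_max_of_le_left ?_) (by positivity)
  exact_mod_cast Finset.card_le_card Finset.inter_subset_left

/-! ### Measurability of thresholds, e-values and selections -/

lemma measurable_card_filter {Ω ι : Type*} [MeasurableSpace Ω] [Fintype ι]
    (P : Ω → ι → Prop) [∀ ω, DecidablePred (P ω)] (hP : ∀ i, MeasurableSet {ω | P ω i}) :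
    Measurable fun ω => (Finset.univ.filter (P ω)).card := by
  classical
  simp only [Finset.card_filter]
  refine Finset.measurable_sum _ fun i _ => ?_
  convert Measurable.ite (hP i) (measurable_const (a := 1)) (measurable_const (a := 0)) using 1

lemma measurableSet_stopCondition {p : ℕ} (α : ℝ) (i : Fin p) :
    MeasurableSet {w : Fin p → ℝ | StopCondition α w |w i|} := by
  have h1 : Measurable fun w : Fin p → ℝ =>
      ((Finset.univ.filter fun j => w j ≤ -|w i|).card : ℝ) :=
    measurable_from_top.comp (measurable_card_filter (fun (w : Fin p → ℝ) j => w j ≤ -|w i|) fun j =>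
      measurableSet_le (by fun_prop) (by fun_prop))
  have h2 : Measurable fun w : Fin p → ℝ =>
      ((Finset.univ.filter fun j => |w i| ≤ w j).card : ℝ) :=
    measurable_from_top.comp (measurable_card_filter (fun (w : Fin p → ℝ) j => |w i| ≤ w j) fun j =>
      measurableSet_le (by fun_prop) (by fun_prop))
  exact (measurableSet_le (h1.const_add 1) (h2.const_mul α)).union
    (measurableSet_lt h2 measurable_const)

open Classical in
-- Here the index set no longer depends on `w`; inadmissible indices contribute `⊤`. Measurability
-- then follows termwise.
lemma threshold_eq_iInf {p : ℕ} (α : ℝ) (w : Fin p → ℝ) :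
    threshold α w = ⨅ i, if 0 < |w i| ∧ StopCondition α w |w i| then ((|w i| : ℝ) : EReal)
      else ⊤ := by
  apply le_antisymm
  · refine le_iInf fun i => ?_
    split_ifs with h
    · exact sInf_le ⟨|w i|, rfl, h.1, ⟨i, rfl⟩, h.2⟩
    · exact le_top
  · refine le_sInf ?_
    rintro x ⟨t, rfl, h1, ⟨i, rfl⟩, h2⟩
    exact (iInf_le _ i).trans (by rw [if_pos ⟨h1, h2⟩])

lemma measurable_threshold {p : ℕ} (α : ℝ) :
    Measurable fun w : Fin p → ℝ => threshold α w := by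
  classical
  simp only [threshold_eq_iInf]
  refine Measurable.iInf fun i => Measurable.ite ?_ ?_ measurable_const
  · exact (measurableSet_lt measurable_const (measurable_pi_apply i).abs).inter (measurableSet_stopCondition α i)
  · exact measurable_coe_real_ereal.comp
      (measurable_pi_apply i).abs

lemma measurable_eValue {p : ℕ} (α : ℝ) (j : Fin p) :
    Measurable fun w : Fin p → ℝ => eValue α w j := by
  classical
  have hT := measurable_threshold (p := p) α
  have hc : ∀ k, Measurable fun w : Fin p → ℝ => ((w k : ℝ) : EReal) := fun k =>
    measurable_coe_real_ereal.comp (measurable_pi_apply k)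
  unfold eValue
  refine Measurable.const_mul (Measurable.div
    (Measurable.ite (measurableSet_le hT (hc j)) measurable_const measurable_const)
    (Measurable.const_add (measurable_from_top.comp (measurable_card_filter
      (fun (w : Fin p → ℝ) k => (w k : EReal) ≤ -threshold α w) fun k => ?_)) 1)) _
  exact measurableSet_le (hc k) hT.neg

lemma measurable_finset_sup_nat {Ω ι : Type*} [MeasurableSpace Ω] (S : Finset ι)
    {f : ι → Ω → ℕ} (hf : ∀ i, Measurable (f i)) : Measurable fun ω => S.sup fun i => f i ω := by
  classical
  induction S using Finset.induction_on with
  | empty => exact measurable_const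
  | insert i S _ ih =>
    simp only [Finset.sup_insert]
    exact (hf i).max ih

lemma measurable_kHat {p : ℕ} (α : ℝ) : Measurable fun e : Fin p → ℝ => kHat α e := by
  classical
  have h : ∀ e : Fin p → ℝ, kHat α e = Finset.univ.sup fun i : Fin p =>
      if (p : ℝ) / (α * ((i : ℕ) + 1 : ℕ)) ≤ orderStat e i then (i : ℕ) + 1 else 0 := by
    intro e
    rw [kHat, Finset.sup_ite]
    simp
  simp only [h]
  refine measurable_finset_sup_nat _ fun i => Measurable.ite ?_ measurable_const measurable_const
  simp only [le_orderStat_iff]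
  exact measurableSet_lt measurable_const (measurable_card_filter
    (fun (e : Fin p → ℝ) j => (p : ℝ) / (α * ((i : ℕ) + 1 : ℕ)) ≤ e j)
    fun j => measurableSet_le measurable_const (measurable_pi_apply j))

lemma measurableSet_mem_ebhSet {p : ℕ} (α : ℝ) (j : Fin p) :
    MeasurableSet {e : Fin p → ℝ | j ∈ ebhSet α e} := by
  have hk := measurable_kHat (p := p) α
  simp only [ebhSet, Finset.mem_filter, Finset.mem_univ, true_and]
  refine (measurableSet_lt measurable_const hk).inter
    (measurableSet_le (measurable_const.div ?_) (measurable_pi_apply j))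
  exact (measurable_from_top.comp hk).const_mul α

lemma measurable_fdp_ebhSet {p : ℕ} (α : ℝ) (H : Finset (Fin p)) :
    Measurable fun e : Fin p → ℝ => fdp (ebhSet α e) H := by
  classical
  have h : ∀ K : Finset (Fin p), Measurable fun e : Fin p → ℝ => ((ebhSet α e ∩ K).card : ℝ) := by
    intro K
    have hK : ∀ e : Fin p → ℝ, ebhSet α e ∩ K =
        Finset.univ.filter fun j => j ∈ ebhSet α e ∧ j ∈ K := fun e => by ext; simp
    simp only [hK]
    exact measurable_from_top.comp (measurable_card_filter
      (fun (e : Fin p → ℝ) j => j ∈ ebhSet α e ∧ j ∈ K) fun j =>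
        (measurableSet_mem_ebhSet α j).inter (MeasurableSet.const _))
  have h' := h Finset.univ
  simp only [Finset.inter_univ] at h'
  exact (h H).div (h'.max measurable_const)

/-! ### Gram matrix of the augmented design and the swapping reflection -/

lemma sqrt_knockoffCov {n p : ℕ} {X : Matrix (Fin n) (Fin p) ℝ} {s : Fin p → ℝ}
    (h : (knockoffCov X s).PosSemidef) :
    (CFC.sqrt (knockoffCov X s)).transpose * CFC.sqrt (knockoffCov X s) = knockoffCov X s := by
  have h1 : (CFC.sqrt (knockoffCov X s)).PosSemidef :=
    Matrix.nonneg_iff_posSemidef.1 (CFC.sqrt_nonneg _)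
  have h2 : (CFC.sqrt (knockoffCov X s)).transpose = CFC.sqrt (knockoffCov X s) := by
    have := h1.isHermitian
    rwa [Matrix.IsHermitian, Matrix.conjTranspose_eq_transpose_of_trivial] at this
  rw [h2]
  exact CFC.sqrt_mul_sqrt_self _ (Matrix.nonneg_iff_posSemidef.2 h)

lemma transpose_mul_knockoffMatrix {n p : ℕ} {X U : Matrix (Fin n) (Fin p) ℝ} {s : Fin p → ℝ}
    (hX : IsUnit (X.transpose * X).det) (hU : U ∈ orthonormalTo X) :
    X.transpose * knockoffMatrix X s U = X.transpose * X - Matrix.diagonal s := by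
  have hXU : X.transpose * U = 0 := by
    have := congrArg Matrix.transpose hU.2
    simpa using this
  unfold knockoffMatrix
  rw [Matrix.mul_sub, ← Matrix.mul_assoc, ← Matrix.mul_assoc, hXU, Matrix.zero_mul, sub_zero,
    Matrix.mul_sub, Matrix.mul_one, Matrix.mul_nonsing_inv_cancel_left _ _ hX]

/-- The cross terms vanish since `U` is orthogonal to `X`. With `D = diag(s)`, the first block gives
`Σ - 2D + D Σ⁻¹ D`, and the covariance `2D - D Σ⁻¹ D` of the second restores `Σ`. -/
lemma knockoffMatrix_gram {n p : ℕ} {X U : Matrix (Fin n) (Fin p) ℝ} {s : Fin p → ℝ}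
    (hX : IsUnit (X.transpose * X).det) (hs : (knockoffCov X s).PosSemidef)
    (hU : U ∈ orthonormalTo X) :
    (knockoffMatrix X s U).transpose * knockoffMatrix X s U = X.transpose * X := by
  have hXU : X.transpose * U = 0 := by
    have := congrArg Matrix.transpose hU.2
    simpa using this
  set A := 1 - (X.transpose * X)⁻¹ * Matrix.diagonal s with hA
  set R := CFC.sqrt (knockoffCov X s) with hR
  have hK : knockoffMatrix X s U = X * A - U * R := rfl
  have hRR : R.transpose * R = knockoffCov X s := sqrt_knockoffCov hs
  have hexp : (X * A - U * R).transpose * (X * A - U * R) =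
      A.transpose * (X.transpose * X) * A + R.transpose * R := by
    have e1 : A.transpose * X.transpose * (U * R) = 0 := by
      rw [Matrix.mul_assoc, ← Matrix.mul_assoc X.transpose, hXU]; simp
    have e2 : R.transpose * U.transpose * (X * A) = 0 := by
      rw [Matrix.mul_assoc, ← Matrix.mul_assoc U.transpose, hU.2]; simp
    have e3 : R.transpose * U.transpose * (U * R) = R.transpose * R := by
      rw [Matrix.mul_assoc, ← Matrix.mul_assoc U.transpose, hU.1]; simp
    rw [Matrix.transpose_sub, Matrix.transpose_mul, Matrix.transpose_mul, Matrix.sub_mul,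
      Matrix.mul_sub _ (X * A), Matrix.mul_sub _ (X * A), e1, e2, e3]
    simp only [Matrix.mul_assoc]
    abel
  rw [hK, hexp, hRR]
  set S := X.transpose * X with hS
  set D := Matrix.diagonal s
  have hSt : S.transpose = S := by simp [hS]
  have hAt : A.transpose = 1 - D * S⁻¹ := by
    rw [hA, Matrix.transpose_sub, Matrix.transpose_mul, Matrix.transpose_nonsing_inv, hSt]
    simp [D]
  have h1 : (1 - D * S⁻¹) * S = S - D := by
    rw [Matrix.sub_mul, Matrix.one_mul, Matrix.mul_assoc, Matrix.nonsing_inv_mul _ hX,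
      Matrix.mul_one]
  have h2 : S * (S⁻¹ * D) = D := Matrix.mul_nonsing_inv_cancel_left _ _ hX
  rw [hAt, h1, hA, Matrix.mul_sub, Matrix.mul_one, Matrix.sub_mul, h2, knockoffCov,
    Matrix.mul_assoc D, two_smul]
  abel

/-- The columns of a matrix, as vectors of a Euclidean space. -/
noncomputable def colVec {n : ℕ} {ι : Type*} (G : Matrix (Fin n) ι ℝ) (k : ι) :
    EuclideanSpace ℝ (Fin n) :=
  WithLp.toLp 2 fun i => G i k

lemma inner_colVec {n : ℕ} {ι κ : Type*} (G : Matrix (Fin n) ι ℝ) (H : Matrix (Fin n) κ ℝ)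
    (k : ι) (l : κ) : inner ℝ (colVec G k) (colVec H l) = (G.transpose * H) k l := by
  simp [colVec, PiLp.inner_apply, Matrix.mul_apply, mul_comm]

lemma inner_colVec_toLp {n : ℕ} {ι : Type*} (G : Matrix (Fin n) ι ℝ) (k : ι) (y : Fin n → ℝ) :
    inner ℝ (colVec G k) (WithLp.toLp 2 y) = G.transpose.mulVec y k := by
  simp [colVec, PiLp.inner_apply, Matrix.mulVec, dotProduct, mul_comm]

/-- An isometry that exchanges the `j`-th feature with its knockoff and fixes the remaining columns
of the augmented design. -/
lemma exists_isometry_swapCols {n p : ℕ} {X U : Matrix (Fin n) (Fin p) ℝ} {s : Fin p → ℝ}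
    (hX : IsUnit (X.transpose * X).det) (hs : (knockoffCov X s).PosSemidef)
    (hU : U ∈ orthonormalTo X) (j : Fin p) :
    ∃ R : EuclideanSpace ℝ (Fin n) ≃ₗᵢ[ℝ] EuclideanSpace ℝ (Fin n), (∀ x, R (R x) = x) ∧
      ∀ k, R (colVec (Matrix.fromCols X (knockoffMatrix X s U)) k) =
        colVec (swapCols j (Matrix.fromCols X (knockoffMatrix X s U))) k := by
  set K := knockoffMatrix X s U with hK
  set G := Matrix.fromCols X K with hG
  have hXK : X.transpose * K = X.transpose * X - Matrix.diagonal s :=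
    transpose_mul_knockoffMatrix hX hU
  have hKK : K.transpose * K = X.transpose * X := knockoffMatrix_gram hX hs hU
  have hxx : ∀ k l, inner ℝ (colVec X k) (colVec X l) = (X.transpose * X) k l :=
    fun k l => inner_colVec X X k l
  have hkk : ∀ k l, inner ℝ (colVec K k) (colVec K l) = (X.transpose * X) k l := fun k l => by
    rw [inner_colVec, hKK]
  have hxk : ∀ k l, inner ℝ (colVec X k) (colVec K l) =
      (X.transpose * X) k l - Matrix.diagonal s k l := fun k l => by
    rw [inner_colVec, hXK]; rfl
  have hkx : ∀ k l, inner ℝ (colVec K k) (colVec X l) =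
      (X.transpose * X) k l - Matrix.diagonal s k l := fun k l => by
    have hsymm : (X.transpose * X) l k = (X.transpose * X) k l := by
      rw [← hxx, ← hxx, real_inner_comm]
    have hd : Matrix.diagonal s l k = Matrix.diagonal s k l := by
      rw [← Matrix.transpose_apply (Matrix.diagonal s), Matrix.diagonal_transpose]
    rw [real_inner_comm, hxk, hsymm, hd]
  have hnorm : ‖colVec X j‖ = ‖colVec K j‖ := by
    have : ‖colVec X j‖ ^ 2 = ‖colVec K j‖ ^ 2 := by
      rw [← real_inner_self_eq_norm_sq, ← real_inner_self_eq_norm_sq, hxx, hkk]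
    exact (sq_eq_sq₀ (norm_nonneg _) (norm_nonneg _)).1 this
  -- Reflection in the hyperplane orthogonal to the difference of two vectors of equal norm
  -- exchanges them.
  set V := (Submodule.span ℝ {colVec X j - colVec K j})ᗮ with hV
  have hmem : ∀ u, inner ℝ (colVec X j - colVec K j) u = 0 → V.reflection u = u := by
    intro u hu
    exact Submodule.reflection_mem_subspace_eq_self
      (Submodule.mem_orthogonal_singleton_iff_inner_right.2 hu)
  have hXj : V.reflection (colVec X j) = colVec K j := Submodule.reflection_sub hnorm
  have hKj : V.reflection (colVec K j) = colVec X j := 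
    (congrArg V.reflection hXj).symm.trans (Submodule.reflection_reflection V _)
  refine ⟨V.reflection, fun x => Submodule.reflection_reflection _ _, ?_⟩
  have hcl : ∀ k, colVec G (Sum.inl k) = colVec X k := fun k => rfl
  have hcr : ∀ k, colVec G (Sum.inr k) = colVec K k := fun k => rfl
  have hsw : ∀ k, colVec (swapCols j G) k =
      colVec G (Equiv.swap (Sum.inl j) (Sum.inr j) k) := fun k => rfl
  rintro (k | k)
  · rw [hsw, hcl]
    by_cases h : k = j
    · subst h; rw [Equiv.swap_apply_left, hXj, hcr]
    · rw [Equiv.swap_apply_of_ne_of_ne (by simpa using h) (by simp), hcl]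
      -- The Gram blocks differ only by `diag(s)`, so for `k ≠ j` this column has equal inner
      -- products with the `j`-th feature and its knockoff, and lies in the hyperplane.
      apply hmem
      rw [inner_sub_left, hxx, hkx, Matrix.diagonal_apply_ne _ (Ne.symm h)]; ring
  · rw [hsw, hcr]
    by_cases h : k = j
    · subst h; rw [Equiv.swap_apply_right, hKj, hcl]
    · rw [Equiv.swap_apply_of_ne_of_ne (by simp) (by simpa using h), hcr]
      apply hmem
      rw [inner_sub_left, hxk, hkk, Matrix.diagonal_apply_ne _ (Ne.symm h)]; ring

/-! ### Gaussian invariance and sign symmetry of the nulls -/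

lemma map_pi_gaussianReal_isometry {n : ℕ}
    (R : EuclideanSpace ℝ (Fin n) ≃ₗᵢ[ℝ] EuclideanSpace ℝ (Fin n)) :
    (Measure.pi fun _ : Fin n => gaussianReal 0 1).map
      (fun z => WithLp.ofLp (R (WithLp.toLp 2 z))) = Measure.pi fun _ => gaussianReal 0 1 := by
  have h1 := map_pi_eq_stdGaussian (ι := Fin n)
  have h2 := stdGaussian_map R
  rw [← h1, Measure.map_map (by fun_prop) (by fun_prop)] at h2
  have h3 := congrArg (fun ν => ν.map (WithLp.ofLp : EuclideanSpace ℝ (Fin n) → _)) h2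
  simp only at h3
  rw [Measure.map_map (by fun_prop) (by fun_prop),
    Measure.map_map (by fun_prop) (by fun_prop)] at h3
  exact h3.trans Measure.map_id

lemma colVec_sum_mulVec {n p : ℕ} (X : Matrix (Fin n) (Fin p) ℝ) (β : Fin p → ℝ) :
    WithLp.toLp 2 (X.mulVec β) = ∑ k, β k • colVec X k := by
  ext i
  simp [colVec, Matrix.mulVec, dotProduct, mul_comm]

/-- Flipping the sign of a null statistic does not change the law of the statistics, for a fixed
knockoff matrix. -/
lemma integral_flipSign {n p : ℕ} {X U : Matrix (Fin n) (Fin p) ℝ} {s : Fin p → ℝ}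
    (hX : IsUnit (X.transpose * X).det) (hs : (knockoffCov X s).PosSemidef)
    (hU : U ∈ orthonormalTo X)
    {W : Matrix (Fin n) (Fin p ⊕ Fin p) ℝ → (Fin n → ℝ) → (Fin p → ℝ)}
    (hW : IsFeatureStatistic W) {β : Fin p → ℝ} {j : Fin p} (hj : β j = 0)
    {g : (Fin p → ℝ) → ℝ} (hg : Measurable g) :
    ∫ z, g (flipSign j (W (Matrix.fromCols X (knockoffMatrix X s U)) (X.mulVec β + z)))
        ∂(Measure.pi fun _ => gaussianReal 0 1) =
      ∫ z, g (W (Matrix.fromCols X (knockoffMatrix X s U)) (X.mulVec β + z))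
        ∂(Measure.pi fun _ => gaussianReal 0 1) := by
  obtain ⟨R, hRR, hR⟩ := exists_isometry_swapCols hX hs hU j
  set G := Matrix.fromCols X (knockoffMatrix X s U) with hG
  obtain ⟨f, hf⟩ := hW.sufficiency
  -- The only column of `X` that `R` may move carries the coefficient `β j = 0`.
  have hfix : R (WithLp.toLp 2 (X.mulVec β)) = WithLp.toLp 2 (X.mulVec β) := by
    rw [colVec_sum_mulVec, map_sum]
    refine Finset.sum_congr rfl fun k _ => ?_
    rw [map_smul]
    by_cases h : k = j
    · subst h; simp [hj]
    · congr 1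
      have := hR (Sum.inl k)
      have h2 : colVec (swapCols j G) (Sum.inl k) =
        colVec G (Equiv.swap (Sum.inl j) (Sum.inr j) (Sum.inl k)) := rfl
      rw [h2, Equiv.swap_apply_of_ne_of_ne (by simpa using h) (by simp)] at this
      exact this
  -- An involutive isometry is self-adjoint, so `R` can be moved from the design onto the response.
  have hinner : ∀ x y, inner ℝ (R x) y = inner ℝ x (R y) := fun x y => by
    rw [← R.inner_map_map x (R y), hRR]
  have hgram : (swapCols j G).transpose * swapCols j G = G.transpose * G := by
    ext k l
    rw [← inner_colVec, ← hR, ← hR, R.inner_map_map, inner_colVec]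
  have hswap : ∀ z, W (swapCols j G) (X.mulVec β + z) =
      W G (X.mulVec β + WithLp.ofLp (R (WithLp.toLp 2 z))) := by
    intro z
    rw [hf, hf, hgram]
    congr 1
    ext k
    rw [← inner_colVec_toLp, ← inner_colVec_toLp, ← hR, hinner, WithLp.toLp_add, map_add, hfix,
      WithLp.toLp_add]
  have hmeas : Measurable fun z => g (W G (X.mulVec β + z)) :=
    hg.comp (hW.measurable.comp (measurable_const.prodMk (measurable_const.add measurable_id)))
  simp_rw [flipSign, ← hW.antisymmetry, hswap]
  conv_rhs => rw [← map_pi_gaussianReal_isometry R]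
  rw [integral_map (by fun_prop) hmeas.aestronglyMeasurable]

/-! ### Expectation of the null e-values -/

lemma measurable_fromCols_knockoffMatrix {n p : ℕ} (X : Matrix (Fin n) (Fin p) ℝ)
    (s : Fin p → ℝ) :
    Measurable fun U : Matrix (Fin n) (Fin p) ℝ => Matrix.fromCols X (knockoffMatrix X s U) := by
  refine measurable_pi_iff.2 fun i => measurable_pi_iff.2 fun k => ?_
  rcases k with k | k
  · exact measurable_const
  · refine Measurable.sub measurable_const ?_
    simp only [Matrix.mul_apply]
    exact Finset.measurable_sum _ fun l _ => Measurable.mul_const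
      ((measurable_pi_apply l).comp (measurable_pi_apply i)) _

lemma integrable_eValue {p : ℕ} (α : ℝ) (j : Fin p) {Ω : Type*} [MeasurableSpace Ω]
    (μ : Measure Ω) [IsFiniteMeasure μ] {w : Ω → Fin p → ℝ} (hw : AEMeasurable w μ) :
    Integrable (fun ω => eValue α (w ω) j) μ := by
  refine Integrable.of_bound
    ((measurable_eValue α j).comp_aemeasurable hw).aestronglyMeasurable (p : ℝ)
    (Filter.Eventually.of_forall fun ω => ?_)
  rw [Real.norm_of_nonneg (eValue_nonneg _ _ _)]
  exact eValue_le _ _ _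

lemma measurable_statistic {n p : ℕ} (X : Matrix (Fin n) (Fin p) ℝ) (s : Fin p → ℝ)
    {W : Matrix (Fin n) (Fin p ⊕ Fin p) ℝ → (Fin n → ℝ) → (Fin p → ℝ)}
    (hW : IsFeatureStatistic W) (β : Fin p → ℝ) :
    Measurable fun q : Matrix (Fin n) (Fin p) ℝ × (Fin n → ℝ) =>
      W (Matrix.fromCols X (knockoffMatrix X s q.1)) (X.mulVec β + q.2) :=
  hW.measurable.comp (((measurable_fromCols_knockoffMatrix X s).comp measurable_fst).prodMk
    (measurable_snd.const_add _))

lemma aemeasurable_statistic {n p : ℕ} (X : Matrix (Fin n) (Fin p) ℝ) (s : Fin p → ℝ)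
    {W : Matrix (Fin n) (Fin p ⊕ Fin p) ℝ → (Fin n → ℝ) → (Fin p → ℝ)}
    (hW : IsFeatureStatistic W) (β : Fin p → ℝ) {Ω : Type*} [MeasurableSpace Ω] {μ : Measure Ω}
    {U : Ω → Matrix (Fin n) (Fin p) ℝ} {z : Ω → Fin n → ℝ} (hU : AEMeasurable U μ)
    (hz : AEMeasurable z μ) :
    AEMeasurable (fun ω => W (Matrix.fromCols X (knockoffMatrix X s (U ω)))
      (X.mulVec β + z ω)) μ := by
  have h := (measurable_statistic X s hW β).comp_aemeasurable (hU.prodMk hz)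
  exact h

/-- For a fixed knockoff matrix, the null e-values have total expectation at most `p`. -/
lemma integral_sum_eValue_le {n p : ℕ} (α : ℝ) {X U : Matrix (Fin n) (Fin p) ℝ} {s : Fin p → ℝ}
    (hX : IsUnit (X.transpose * X).det) (hs : (knockoffCov X s).PosSemidef)
    (hU : U ∈ orthonormalTo X)
    {W : Matrix (Fin n) (Fin p ⊕ Fin p) ℝ → (Fin n → ℝ) → (Fin p → ℝ)}
    (hW : IsFeatureStatistic W) (β : Fin p → ℝ) :
    ∫ z, ∑ j ∈ nulls β,
        eValue α (W (Matrix.fromCols X (knockoffMatrix X s U)) (X.mulVec β + z)) j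
        ∂(Measure.pi fun _ => gaussianReal 0 1) ≤ p := by
  have hw : Measurable fun z => W (Matrix.fromCols X (knockoffMatrix X s U)) (X.mulVec β + z) := by
    have h := (measurable_statistic X s hW β).comp
      ((measurable_const (a := U)).prodMk measurable_id)
    exact h
  have hflip : ∀ j, Measurable (flipSign j : (Fin p → ℝ) → Fin p → ℝ) := fun j => by
    unfold flipSign; fun_prop
  have hwf : ∀ j, Measurable fun z => flipSign j
      (W (Matrix.fromCols X (knockoffMatrix X s U)) (X.mulVec β + z)) := fun j => (hflip j).comp hw
  have hint : ∀ j, Integrable (fun z => eValue α (flipSign j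
      (W (Matrix.fromCols X (knockoffMatrix X s U)) (X.mulVec β + z))) j)
      (Measure.pi fun _ => gaussianReal 0 1) := fun j =>
    integrable_eValue α j _ (hwf j).aemeasurable
  rw [integral_finsetSum _ fun j _ => integrable_eValue α j _ hw.aemeasurable]
  have hsum : ∀ j ∈ nulls β, ∫ z, eValue α
      (W (Matrix.fromCols X (knockoffMatrix X s U)) (X.mulVec β + z)) j
        ∂(Measure.pi fun _ => gaussianReal 0 1) = ∫ z, eValue α (flipSign j
      (W (Matrix.fromCols X (knockoffMatrix X s U)) (X.mulVec β + z))) j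
        ∂(Measure.pi fun _ => gaussianReal 0 1) := fun j hj =>
    (integral_flipSign hX hs hU hW (Finset.mem_filter.1 hj).2 (measurable_eValue α j)).symm
  rw [Finset.sum_congr rfl hsum, ← integral_finsetSum _ fun j _ => hint j]
  refine (integral_mono (integrable_finsetSum _ fun j _ => hint j) (integrable_const (p : ℝ))
    fun z => ?_).trans (by simp)
  -- After the flips all terms involve the same vector `w`, so the sum can be enlarged to all `j`
  -- and bounded pointwise.
  exact (Finset.sum_le_sum_of_subset_of_nonneg (Finset.subset_univ _)
    fun j _ _ => eValue_nonneg _ _ _).trans (sum_eValue_flipSign_le α _)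

/-- Independence makes the joint law of `(U, ε)` a product, so Fubini reduces to the bound for a
fixed `U`, valid for almost every `U`. -/
lemma expectation_sum_eValue_le {n p : ℕ} (α : ℝ) {X : Matrix (Fin n) (Fin p) ℝ} {s : Fin p → ℝ}
    (hX : IsUnit (X.transpose * X).det) (hs : (knockoffCov X s).PosSemidef)
    {W : Matrix (Fin n) (Fin p ⊕ Fin p) ℝ → (Fin n → ℝ) → (Fin p → ℝ)}
    (hW : IsFeatureStatistic W) (β : Fin p → ℝ)
    {Ω : Type*} [MeasurableSpace Ω] (μ : Measure Ω) [IsProbabilityMeasure μ]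
    {ε : Ω → Fin n → ℝ} (hε : HasLaw ε (Measure.pi fun _ => gaussianReal 0 1) μ)
    {U : Ω → Matrix (Fin n) (Fin p) ℝ} (hUm : AEMeasurable U μ)
    (hU : ∀ᵐ V ∂μ.map U, V ∈ orthonormalTo X) (hUε : IndepFun U ε μ) :
    ∫ ω, ∑ j ∈ nulls β,
        eValue α (W (Matrix.fromCols X (knockoffMatrix X s (U ω))) (X.mulVec β + ε ω)) j ∂μ
      ≤ p := by
  have : IsProbabilityMeasure (μ.map U) := Measure.isProbabilityMeasure_map hUm
  have hlaw := (indepFun_iff_map_prod_eq_prod_map_map hUm hε.aemeasurable).1 hUε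
  rw [hε.map_eq] at hlaw
  have hw := measurable_statistic X s hW β
  have hint : Integrable (fun q : Matrix (Fin n) (Fin p) ℝ × (Fin n → ℝ) => ∑ j ∈ nulls β,
      eValue α (W (Matrix.fromCols X (knockoffMatrix X s q.1)) (X.mulVec β + q.2)) j)
      ((μ.map U).prod (Measure.pi fun _ => gaussianReal 0 1)) :=
    integrable_finsetSum _ fun j _ => integrable_eValue α j _ hw.aemeasurable
  have h1 := integral_map (hUm.prodMk hε.aemeasurable) (by rw [hlaw]; exact hint.1)
  rw [← h1, hlaw, integral_prod _ hint]
  refine (integral_mono_ae hint.integral_prod_left (integrable_const (p : ℝ)) ?_).trans (by simp)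
  filter_upwards [hU] with V hV
  exact integral_sum_eValue_le α hX hs hV hW β

end FixedXKnockoffs

/-! ### The FDR bound -/

open FixedXKnockoffs in
theorem theoremA1 {n p M : ℕ} (hM : 1 ≤ M)
    (αkn αebh : ℝ) (hαkn : αkn ∈ Set.Ioo (0 : ℝ) 1) (hαebh : αebh ∈ Set.Ioo (0 : ℝ) 1)
    (X : Matrix (Fin n) (Fin p) ℝ) (hX : IsUnit (X.transpose * X).det)
    (β : Fin p → ℝ)
    (s : Fin p → ℝ) (hs : ∀ j, 0 ≤ s j)
    (hspsd : (FixedXKnockoffs.knockoffCov X s).PosSemidef)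
    (W : Fin M → Matrix (Fin n) (Fin p ⊕ Fin p) ℝ → (Fin n → ℝ) → (Fin p → ℝ))
    (hW : ∀ m, FixedXKnockoffs.IsFeatureStatistic (W m))
    {Ω : Type*} [MeasurableSpace Ω] (μ : Measure Ω) [IsProbabilityMeasure μ]
    (ε : Ω → Fin n → ℝ) (hε : HasLaw ε (Measure.pi fun _ => gaussianReal 0 1) μ)
    (U : Fin M → Ω → Matrix (Fin n) (Fin p) ℝ)
    (hU : ∀ m, AEMeasurable (U m) μ ∧ FixedXKnockoffs.IsUniformOrthonormalTo X (μ.map (U m)))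
    (hUε : IndepFun (fun ω m => U m ω) ε μ)
    (Y : Ω → Fin n → ℝ) (hY : ∀ ω, Y ω = X.mulVec β + ε ω) :
    Integrable (fun ω => FixedXKnockoffs.fdp
      (FixedXKnockoffs.derandomizedSelection αkn αebh X s W (fun m => U m ω) (Y ω))
      (FixedXKnockoffs.nulls β)) μ ∧
    ∫ ω, FixedXKnockoffs.fdp
      (FixedXKnockoffs.derandomizedSelection αkn αebh X s W (fun m => U m ω) (Y ω))
      (FixedXKnockoffs.nulls β) ∂μ ≤ αebh := by
  set w : Fin M → Ω → Fin p → ℝ := fun m ω =>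
    W m (Matrix.fromCols X (knockoffMatrix X s (U m ω))) (X.mulVec β + ε ω) with hwdef
  have hw : ∀ m, AEMeasurable (w m) μ := fun m =>
    aemeasurable_statistic X s (hW m) β (hU m).1 hε.aemeasurable
  set e : Ω → Fin p → ℝ := fun ω j => (1 / (M : ℝ)) * ∑ m, eValue αkn (w m ω) j with hedef
  have hsel : ∀ ω, derandomizedSelection αkn αebh X s W (fun m => U m ω) (Y ω) =
      ebhSet αebh (e ω) := fun ω => by
    rw [hY]; rfl
  simp only [hsel]
  have he : AEMeasurable e μ := aemeasurable_pi_lambda _ fun j =>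
    (Finset.aemeasurable_fun_sum _ fun m _ =>
      (measurable_eValue αkn j).comp_aemeasurable (hw m)).const_mul _
  have he0 : ∀ ω j, 0 ≤ e ω j := fun ω j =>
    mul_nonneg (by positivity) (Finset.sum_nonneg fun m _ => eValue_nonneg _ _ _)
  have hint : Integrable (fun ω => fdp (ebhSet αebh (e ω)) (nulls β)) μ := by
    refine Integrable.of_bound
      ((measurable_fdp_ebhSet αebh (nulls β)).comp_aemeasurable he).aestronglyMeasurable 1
      (Filter.Eventually.of_forall fun ω => ?_)
    rw [Real.norm_of_nonneg (fdp_nonneg _ _)]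
    exact fdp_le_one _ _
  refine ⟨hint, ?_⟩
  have hei : ∀ m, Integrable (fun ω => ∑ j ∈ nulls β, eValue αkn (w m ω) j) μ := fun m =>
    integrable_finsetSum _ fun j _ => integrable_eValue αkn j μ (hw m)
  have hbound : ∀ ω, fdp (ebhSet αebh (e ω)) (nulls β) ≤
      αebh / p * ((1 / (M : ℝ)) * ∑ m, ∑ j ∈ nulls β, eValue αkn (w m ω) j) := fun ω => by
    refine (fdp_ebhSet_le hαebh.1 (he0 ω) _).trans_eq ?_
    rw [hedef, ← Finset.mul_sum, Finset.sum_comm]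
  have hm : ∀ m, ∫ ω, ∑ j ∈ nulls β, eValue αkn (w m ω) j ∂μ ≤ p := fun m =>
    expectation_sum_eValue_le αkn hX hspsd (hW m) β μ hε (hU m).1 (hU m).2.ae_mem
      (hUε.comp (measurable_pi_apply m) measurable_id)
  have hMpos : (0 : ℝ) < M := by exact_mod_cast hM
  calc ∫ ω, fdp (ebhSet αebh (e ω)) (nulls β) ∂μ
      ≤ ∫ ω, αebh / p * ((1 / (M : ℝ)) * ∑ m, ∑ j ∈ nulls β, eValue αkn (w m ω) j) ∂μ :=
        integral_mono hint (((integrable_finsetSum _ fun m _ => hei m).const_mul _).const_mul _)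
          hbound
    _ = αebh / p * ((1 / (M : ℝ)) * ∑ m, ∫ ω, ∑ j ∈ nulls β, eValue αkn (w m ω) j ∂μ) := by
        rw [integral_const_mul, integral_const_mul, integral_finsetSum _ fun m _ => hei m]
    _ ≤ αebh / p * ((1 / (M : ℝ)) * ∑ _m : Fin M, (p : ℝ)) := by
        have := hαebh.1.le
        gcongr with m
        exact hm m
    _ ≤ αebh := by
        rw [Finset.sum_const, Finset.card_univ, Fintype.card_fin, nsmul_eq_mul, one_div,
          inv_mul_cancel_left₀ hMpos.ne']
        -- The factor `p / p` is only bounded by `1`, which also covers `p = 0`.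
        rw [div_mul_comm]
        exact mul_le_of_le_one_left hαebh.1.le (div_self_le_one _)
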